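/- Let $1 \le k < n$ and put $u = n-k$. Let $\mathfrak{C}_{k,n-k} = \mathbb{Z}^2/(-u,k)\mathbb{Z}$, write $\langle i,j\rangle$ for the class of $(i,j)$, and order $\mathfrak{C}_{k,n-k}$ by the partial order generated by $\langle i,j\rangle < \langle i+1,j\rangle$ (weak steps) and $\langle i,j\rangle < \langle i,j+1\rangle$ (strict steps). Rows are the sets of boxes with a fixed $j$ and columns are the sets of boxes with a fixed $i$. A cylindric skew shape is a finite convex subset $C$ of $\mathfrak{C}_{k,n-k}$. For $N \ge 0$ let $$s_C(x_1,\dots,x_N)=\sum_T \prod_{c\in C} x_{T(c)},$$ where $T$ runs over the maps $C\to\{1,\dots,N\}$ that weakly increase along rows (in the direction of increasing $i$) and strictly increase along columns (in the direction of increasing $j$). We say that $C$ is isomorphic to a skew shape if there are partitions $\mu\subseteq\lambda$ and a bijection from $C$ to the set of boxes of $\lambda/\mu$ which, in both directions, preserves the order and preserves the relation "$x$ can be joined to $y$ by an increasing chain of unit steps, at least one of which is strict" (on $\lambda/\mu$, steps along a row are weak and steps from one row to the next within a column are strict). Let $C\subseteq\mathfrak{C}_{k,n-k}$ be a cylindric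 skew shape that is not isomorphic to a skew shape. Let $R=\{\langle i,j\rangle\in C : \langle i+1,j+1\rangle\notin C\}$ be the ribbon that runs all the way along the top of $C$, and let $m$ be the maximum number of elements in a column of $C\setminus R$ (with $m=0$ if $C=R$). Then $s_C(x_1,\dots,x_{m+k+2})$ is not Schur-positive, i.e. it is not a linear combination with nonnegative coefficients of the Schur polynomials $s_\nu(x_1,\dots,x_{m+k+2})$. -/

import Mathlib

namespace CylindricSkew

/-- The cylinder `ℤ² / (-u, v)ℤ`, which has `v` rows and `u` columns. -/
abbrev Cylinder (v u : ℕ) : Type :=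
  (ℤ × ℤ) ⧸ AddSubgroup.zmultiples ((-(u : ℤ), (v : ℤ)) : ℤ × ℤ)

/-- The box `⟨i, j⟩` of the cylinder, lying in column `i` and row `j`. -/
def box (v u : ℕ) (i j : ℤ) : Cylinder v u :=
  QuotientAddGroup.mk (i, j)

/-- The order of the cylinder induced from the componentwise order of `ℤ²`, that is, the order
generated by `⟨i, j⟩ < ⟨i + 1, j⟩` and `⟨i, j⟩ < ⟨i, j + 1⟩`. -/
def Le {v u : ℕ} (x y : Cylinder v u) : Prop :=
  ∃ i j i' j' : ℤ, box v u i j = x ∧ box v u i' j' = y ∧ i ≤ i' ∧ j ≤ j'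

/-- `StrictBelow x y`: one can climb from `x` to `y` by unit steps at least one of which is a
vertical (strict) step `⟨i, j⟩ < ⟨i, j + 1⟩`. -/
def StrictBelow {v u : ℕ} (x y : Cylinder v u) : Prop :=
  ∃ i j i' j' : ℤ, box v u i j = x ∧ box v u i' j' = y ∧ i ≤ i' ∧ j < j'

/-- A cylindric skew shape is a finite convex subset of the cylinder. -/
def IsCylindricSkewShape {v u : ℕ} (C : Finset (Cylinder v u)) : Prop :=
  ∀ x ∈ C, ∀ z ∈ C, ∀ y, Le x y → Le y z → y ∈ C

/-- `C` is isomorphic to a skew shape `lam / mu`: there is a bijection between the boxes that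
matches the two orders and the two strictness relations. A cell `(r, c)` of a Young diagram lies in
row `r` and column `c`; steps from row `r` to row `r + 1` are the strict ones. When the cylinder
has at least two rows and two columns, each unit step is a covering relation and the condition says
that the Hasse diagrams are isomorphic by a map that preserves strict and weak edges. -/
def IsIsomorphicToSkewShape {v u : ℕ} (C : Finset (Cylinder v u)) : Prop :=
  ∃ lam mu : YoungDiagram, mu ≤ lam ∧
    ∃ e : {x // x ∈ C} ≃ {p : ℕ × ℕ // p ∈ lam.cells \ mu.cells},
      (∀ x y : {x // x ∈ C}, Le x.1 y.1 ↔
        (e x).1.1 ≤ (e y).1.1 ∧ (e x).1.2 ≤ (e y).1.2) ∧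
      (∀ x y : {x // x ∈ C}, StrictBelow x.1 y.1 ↔
        (e x).1.1 < (e y).1.1 ∧ (e x).1.2 ≤ (e y).1.2)

/-- A semistandard cylindric tableau of shape `C` with `N` possible entries: weakly increasing
along the rows and strictly increasing up the columns. -/
def IsCylindricTableau {v u N : ℕ} (C : Finset (Cylinder v u)) (T : {x // x ∈ C} → Fin N) : Prop :=
  (∀ (i i' j : ℤ) (h : box v u i j ∈ C) (h' : box v u i' j ∈ C),
      i < i' → T ⟨_, h⟩ ≤ T ⟨_, h'⟩) ∧
  (∀ (i j j' : ℤ) (h : box v u i j ∈ C) (h' : box v u i j' ∈ C),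
      j < j' → T ⟨_, h⟩ < T ⟨_, h'⟩)

open Classical in
/-- The cylindric skew Schur function `s_C(x_1, …, x_N)` in `N` variables. -/
noncomputable def cylindricSchur {v u : ℕ} (N : ℕ) (C : Finset (Cylinder v u)) :
    MvPolynomial (Fin N) ℚ :=
  ∑ T : {x // x ∈ C} → Fin N with IsCylindricTableau C T, ∏ c, MvPolynomial.X (T c)

/-- A semistandard Young tableau of shape `lam` with `N` possible entries: weakly increasing within
each row, strictly increasing in the row index within each column. -/
def IsYoungTableau {N : ℕ} (lam : YoungDiagram) (T : {p // p ∈ lam.cells} → Fin N) : Prop :=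
  (∀ p q : {p // p ∈ lam.cells}, p.1.1 = q.1.1 → p.1.2 < q.1.2 → T p ≤ T q) ∧
  (∀ p q : {p // p ∈ lam.cells}, p.1.2 = q.1.2 → p.1.1 < q.1.1 → T p < T q)

open Classical in
/-- The Schur polynomial `s_lam(x_1, …, x_N)`; it vanishes if `lam` has more than `N` rows. -/
noncomputable def schur (N : ℕ) (lam : YoungDiagram) : MvPolynomial (Fin N) ℚ :=
  ∑ T : {p // p ∈ lam.cells} → Fin N with IsYoungTableau lam T, ∏ c, MvPolynomial.X (T c)

/-- A polynomial in `N` variables is Schur-positive if it is a linear combination of Schur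
polynomials with nonnegative coefficients. -/
def IsSchurPositive {N : ℕ} (f : MvPolynomial (Fin N) ℚ) : Prop :=
  ∃ c : YoungDiagram →₀ ℚ, (∀ lam, 0 ≤ c lam) ∧ f = c.sum fun lam a => a • schur N lam

open Classical in
/-- The ribbon running all the way along the top of `C`: the boxes `⟨i, j⟩` of `C` for which
`⟨i + 1, j + 1⟩` is not in `C`. -/
noncomputable def topRibbon {v u : ℕ} (C : Finset (Cylinder v u)) : Finset (Cylinder v u) :=
  C.filter fun c => c + box v u 1 1 ∉ C

open Classical in
/-- What remains of `C` after its top ribbon is removed. -/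
noncomputable def removeTopRibbon {v u : ℕ} (C : Finset (Cylinder v u)) :
    Finset (Cylinder v u) :=
  C \ topRibbon C

open Classical in
/-- The `q`-th column of `D`; it depends only on `q` modulo `u`. -/
noncomputable def column {v u : ℕ} (D : Finset (Cylinder v u)) (q : ℤ) : Finset (Cylinder v u) :=
  D.filter fun c => ∃ j : ℤ, c = box v u q j

/-- The maximum number of elements in a column of `D` (`0` if `D` is empty). -/
noncomputable def maxColumnCard {v u : ℕ} (D : Finset (Cylinder v u)) : ℕ :=
  (Finset.range u).sup fun q => (column D (q : ℤ)).card

end CylindricSkew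

namespace CylindricSkew

/-! ### Super tableaux and the toggle involution. -/

section Fillings

variable {X : Type} [Fintype X]

/-! A super tableau has ordinary values and one odd largest value, which may repeat up a column but
not along a row. For a symmetric function, the number with content `c` and `i` odd entries is the
pairing with `h_c e_i`. The relation `∑ (-1)^j h_j e_{i-j} = 0` makes it a fixed linear functional
of the polynomial (`exists_linearMap_eq_card_superTableaux`). The relation comes from a toggle of
one corner of an upper set (`exists_toggle`), so it also holds for cylindric shapes as long as the
upper sets are small enough to have corners: fewer than `n` boxes suffice.

On Schur functions, `h_{n-i} e_i` is a sum of two hooks, and each is a summand of a neighbouring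
product. Thus the functional at `i` is at most the sum of those at `i - 1` and `i + 1`, and
Schur-positivity inherits this (`card_superTableaux_le`).

A cylindric shape that is not a skew shape meets all `n` diagonals, so its top ribbon is a closed
loop of `n` boxes. If the two largest values occupy `n` boxes, they fill this loop, and the odd
value sits exactly on the row ends (`mult_eq_card_rowEnds`). Hence the count vanishes unless `i` is
the number `r` of row ends, where the height filling makes it positive: the inequality fails. It
involves `m + 1` ordinary values and up to `r + 1 ≤ k + 1` odd entries, which gives `m + k + 2`
variables. -/

/-- The number of times the value `v` is taken by `T`. -/
def mult {V : Type} [DecidableEq V] (T : X → V) (v : V) : ℕ :=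
  (Finset.univ.filter fun x => T x = v).card

/-- Fillings by `0, …, q` in which the values below `q` repeat only along weak relations `W`
and the value `q` repeats only along strict relations `S`. -/
structure IsSuperTableau (W S : X → X → Prop) (q : ℕ) (T : X → ℕ) : Prop where
  le : ∀ x, T x ≤ q
  weak : ∀ x y, W x y → T x < T y ∨ (T x = T y ∧ T x < q)
  strict : ∀ x y, S x y → T x < T y ∨ (T x = T y ∧ T x = q)

theorem mult_eq_zero {V : Type} [DecidableEq V] {T : X → V} {v : V} :
    mult T v = 0 ↔ ∀ x, T x ≠ v := by
  simp [mult, Finset.filter_eq_empty_iff]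

open Classical in
/-- The fillings of `IsSuperTableau` that take each `v < q` exactly `c v` times and `q` exactly
`i` times. -/
noncomputable def superTableaux (W S : X → X → Prop) (q : ℕ) (c : ℕ → ℕ) (i : ℕ) :
    Finset (X → ℕ) :=
  (Fintype.piFinset fun _ => Finset.range (q + 1)).filter fun T =>
    IsSuperTableau W S q T ∧ (∀ v < q, mult T v = c v) ∧ mult T q = i

theorem mem_superTableaux {W S : X → X → Prop} {q : ℕ} {c : ℕ → ℕ} {i : ℕ} {T : X → ℕ} :
    T ∈ superTableaux W S q c i ↔
      IsSuperTableau W S q T ∧ (∀ v < q, mult T v = c v) ∧ mult T q = i := by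
  classical
  simp only [superTableaux, Finset.mem_filter, Fintype.mem_piFinset, Finset.mem_range,
    and_iff_right_iff_imp]
  exact fun h x => Nat.lt_succ_of_le (h.1.le x)

/-- Every nonempty upper set with at most `i` elements contains an element that is maximal for the
weak relations and minimal for the strict ones. -/
def HasCorners (W S : X → X → Prop) (i : ℕ) : Prop :=
  ∀ J : Finset X, (∀ x ∈ J, ∀ y, W x y ∨ S x y → y ∈ J) → J.Nonempty → J.card ≤ i →
    ∃ x ∈ J, ∀ y ∈ J, ¬ W x y ∧ ¬ S y x

omit [Fintype X] in
theorem HasCorners.mono {W S : X → X → Prop} {i j : ℕ} (h : HasCorners W S j) (hij : i ≤ j) :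
    HasCorners W S i :=
  fun J hJ hne hc => h J hJ hne (hc.trans hij)

open Classical in
theorem mult_update_self {T : X → ℕ} {x : X} {b : ℕ} (h : T x ≠ b) :
    mult (Function.update T x b) b = mult T b + 1 := by
  have : (Finset.univ.filter fun y => Function.update T x b y = b) =
      insert x (Finset.univ.filter fun y => T y = b) := by
    ext y
    by_cases hy : y = x
    · subst hy; simp
    · simp [hy]
  rw [mult, this, Finset.card_insert_of_notMem (by simp [h]), mult]

open Classical in
theorem mult_update_old {T : X → ℕ} {x : X} {b : ℕ} (h : T x ≠ b) :
    mult T (T x) = mult (Function.update T x b) (T x) + 1 := by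
  have h' := mult_update_self (T := Function.update T x b) (x := x) (b := T x)
    (by simpa using h.symm)
  simpa using h'

open Classical in
theorem mult_update_of_ne {T : X → ℕ} {x : X} {b v : ℕ} (hb : v ≠ b) (h : v ≠ T x) :
    mult (Function.update T x b) v = mult T v := by
  unfold mult
  congr 1
  ext y
  by_cases hy : y = x
  · subst hy; simp [hb.symm, h.symm]
  · simp [hy]

open Classical in
theorem mult_add_mult_eq_card {q : ℕ} {T : X → ℕ} (h : ∀ x, T x ≤ q + 1) :
    mult T q + mult T (q + 1) = (Finset.univ.filter fun x => q ≤ T x).card := by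
  rw [mult, mult, ← Finset.card_union_of_disjoint]
  · congr 1
    ext x
    have := h x
    simp only [Finset.mem_union, Finset.mem_filter, Finset.mem_univ, true_and]
    omega
  · rw [Finset.disjoint_left]
    intro x
    simp only [Finset.mem_filter, Finset.mem_univ, true_and]
    omega

/-- An involution on fillings that changes one value `q` to `q + 1` or conversely. -/
theorem exists_toggle {W S : X → X → Prop} {i : ℕ} (hX : HasCorners W S i) (hi : 0 < i) (q : ℕ) :
    ∃ τ : (X → ℕ) → (X → ℕ), ∀ T, IsSuperTableau W S (q + 1) T →
      mult T q + mult T (q + 1) = i →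
      IsSuperTableau W S (q + 1) (τ T) ∧ τ (τ T) = T ∧ (∀ v < q, mult (τ T) v = mult T v) ∧
      ((mult (τ T) q + 1 = mult T q ∧ mult (τ T) (q + 1) = mult T (q + 1) + 1) ∨
       (mult (τ T) q = mult T q + 1 ∧ mult (τ T) (q + 1) + 1 = mult T (q + 1))) := by
  classical
  rcases isEmpty_or_nonempty X with hE | hE
  · refine ⟨id, fun T _ h => ?_⟩
    rw [mult_eq_zero.2 (fun x => isEmptyElim x), mult_eq_zero.2 (fun x => isEmptyElim x)] at h
    omega
  let P : Finset X → X → Prop := fun J x => x ∈ J ∧ ∀ y ∈ J, ¬ W x y ∧ ¬ S y x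
  let up : (X → ℕ) → Finset X := fun T => Finset.univ.filter fun x => q ≤ T x
  -- The chosen corner depends on `T` only through `up T`, which exchanging `q` and `q + 1`
  -- preserves; hence the toggle is an involution.
  let f : (X → ℕ) → X := fun T => Classical.epsilon (P (up T))
  let τ : (X → ℕ) → (X → ℕ) := fun T =>
    Function.update T (f T) (if T (f T) = q then q + 1 else q)
  refine ⟨τ, fun T hT hc => ?_⟩
  rw [mult_add_mult_eq_card hT.le] at hc
  have hf : P (up T) (f T) := by
    apply Classical.epsilon_spec (p := P (up T))
    obtain ⟨x, hx, h⟩ := hX (up T) (fun x hx y hxy => by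
      simp only [up, Finset.mem_filter, Finset.mem_univ, true_and] at hx ⊢
      rcases hxy with h | h
      · have := hT.weak x y h; omega
      · have := hT.strict x y h; omega) (by
      rw [← Finset.card_pos]; exact hc ▸ hi) hc.le
    exact ⟨x, hx, h⟩
  obtain ⟨hfm, hfn⟩ := hf
  have hqx : q ≤ T (f T) := by simpa [up] using hfm
  have hxq : T (f T) ≤ q + 1 := hT.le _
  set x := f T with hx
  set b := (if T x = q then q + 1 else q) with hb
  have hmem : ∀ y, q ≤ T y → ¬ W x y ∧ ¬ S y x := fun y hy => hfn y (by simpa [up] using hy)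
  have hbq : q ≤ b ∧ b ≤ q + 1 ∧ T x ≠ b ∧ b ≠ T x := by
    rw [hb]; split_ifs <;> omega
  have hup : up (Function.update T x b) = up T := by
    ext y
    by_cases hy : y = x
    · subst hy; simp [up, hbq.1, hqx]
    · simp [up, hy]
  have hfup : f (Function.update T x b) = x := by
    simp only [f, hup]; rfl
  have hττ : τ (Function.update T x b) = T := by
    simp only [τ, hfup]
    ext y
    by_cases hy : y = x
    · subst hy
      simp only [Function.update_self]
      rw [hb]; split_ifs <;> omega
    · simp [hy]
  have hτT : τ T = Function.update T x b := rfl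
  rw [hτT]
  clear_value τ x b
  refine ⟨⟨?_, ?_, ?_⟩, ?_, ?_, ?_⟩
  · intro y
    by_cases hy : y = x
    · subst hy; simp [hbq.2.1]
    · simp [hy, hT.le y]
  · intro y z hyz
    have h0 := hT.weak y z hyz
    by_cases hy : y = x
    · subst hy
      exact absurd hyz (hmem z (by omega)).1
    · by_cases hz : z = x
      · subst hz
        simp only [Function.update_self, Function.update_of_ne hy]
        omega
      · simpa only [Function.update_of_ne hz, Function.update_of_ne hy] using h0
  · intro y z hyz
    have h0 := hT.strict y z hyz
    by_cases hz : z = x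
    · subst hz
      have hyq : T y < q := by
        by_contra hcon
        exact (hmem y (by omega)).2 hyz
      have hy : y ≠ z := by rintro rfl; omega
      simp only [Function.update_self, Function.update_of_ne hy]
      omega
    · by_cases hy : y = x
      · subst hy
        simp only [Function.update_self, Function.update_of_ne hz]
        omega
      · simpa only [Function.update_of_ne hz, Function.update_of_ne hy] using h0
  · exact hττ
  · intro v hv
    exact mult_update_of_ne (by omega) (by omega)
  · have h1 := mult_update_self hbq.2.2.1
    have h2 := mult_update_old hbq.2.2.1
    by_cases hTq : T x = q
    · have hb' : b = q + 1 := by simp [hb, hTq]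
      simp only [hTq] at h2
      rw [hb'] at h1 h2 ⊢
      omega
    · have hb' : b = q := by simp [hb, hTq]
      have hTq' : T x = q + 1 := by omega
      simp only [hTq'] at h2
      rw [hb'] at h1 h2 ⊢
      omega

/-- This is `∑ (-1)^j h_j e_{i-j} = 0`: the toggle changes the number of entries `q` by one, so it
pairs fillings of opposite sign. -/
theorem sum_neg_one_pow_mul_card_superTableaux {W S : X → X → Prop} {i : ℕ}
    (hX : HasCorners W S i) (hi : 0 < i) (q : ℕ) (c : ℕ → ℕ) :
    ∑ j ∈ Finset.range (i + 1), (-1 : ℚ) ^ j *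
      (superTableaux W S (q + 1) (Function.update c q j) (i - j)).card = 0 := by
  classical
  obtain ⟨τ, hτ⟩ := exists_toggle hX hi q
  let 𝒯 : Finset (X → ℕ) := (Fintype.piFinset fun _ => Finset.range (q + 2)).filter fun T =>
    IsSuperTableau W S (q + 1) T ∧ (∀ v < q, mult T v = c v) ∧ mult T q + mult T (q + 1) = i
  have hmem : ∀ T, T ∈ 𝒯 ↔ IsSuperTableau W S (q + 1) T ∧ (∀ v < q, mult T v = c v) ∧
      mult T q + mult T (q + 1) = i := by
    intro T
    simp only [𝒯, Finset.mem_filter, Fintype.mem_piFinset, Finset.mem_range,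
      and_iff_right_iff_imp]
    exact fun h x => Nat.lt_succ_of_le (h.1.le x)
  have hzero : ∑ T ∈ 𝒯, (-1 : ℚ) ^ mult T q = 0 := by
    refine Finset.sum_involution (fun T _ => τ T) ?_ ?_ ?_ ?_
    · intro T hT
      rw [hmem] at hT
      obtain ⟨-, -, -, h | h⟩ := hτ T hT.1 hT.2.2
      · rw [← h.1, pow_succ]; ring
      · rw [h.1, pow_succ]; ring
    · intro T hT _ he
      rw [hmem] at hT
      obtain ⟨-, -, -, h⟩ := hτ T hT.1 hT.2.2
      rw [he] at h
      omega
    · intro T hT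
      rw [hmem] at hT ⊢
      obtain ⟨h1, -, h3, h⟩ := hτ T hT.1 hT.2.2
      exact ⟨h1, fun v hv => (h3 v hv).trans (hT.2.1 v hv), by omega⟩
    · intro T hT
      rw [hmem] at hT
      exact (hτ T hT.1 hT.2.2).2.1
  rw [← hzero, ← Finset.sum_fiberwise_of_maps_to (t := Finset.range (i + 1))
    (g := fun T => mult T q)]
  · refine Finset.sum_congr rfl fun j hj => ?_
    rw [Finset.mem_range] at hj
    rw [Finset.sum_congr rfl (g := fun _ => (-1 : ℚ) ^ j)
      (fun T hT => by rw [(Finset.mem_filter.1 hT).2]), Finset.sum_const, nsmul_eq_mul, mul_comm]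
    congr 3
    ext T
    rw [mem_superTableaux, Finset.mem_filter, hmem]
    constructor
    · rintro ⟨h1, h2, h3⟩
      have hq : mult T q = j := by simpa using h2 q (by omega)
      refine ⟨⟨h1, fun v hv => ?_, by omega⟩, hq⟩
      simpa [hv.ne] using h2 v (by omega)
    · rintro ⟨⟨h1, h2, h3⟩, h4⟩
      refine ⟨h1, fun v hv => ?_, by omega⟩
      rcases Nat.lt_succ_iff_lt_or_eq.1 hv with hv | rfl
      · simpa [hv.ne] using h2 v hv
      · simpa using h4
  · intro T hT
    rw [hmem] at hT
    rw [Finset.mem_range]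
    omega

/-- An unused ordinary value can be skipped by renaming the odd one. This identifies the term `j =
0` of the alternating sum, for which the recursion is solved. -/
theorem card_superTableaux_update_zero (W S : X → X → Prop) (q : ℕ) (c : ℕ → ℕ) (i : ℕ) :
    (superTableaux W S (q + 1) (Function.update c q 0) i).card =
      (superTableaux W S q c i).card := by
  classical
  symm
  refine Finset.card_bij' (fun T _ x => if T x = q then q + 1 else T x)
    (fun T _ x => if T x = q + 1 then q else T x) ?_ ?_ ?_ ?_
  · intro T hT
    rw [mem_superTableaux] at hT ⊢
    obtain ⟨h1, h2, h3⟩ := hT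
    refine ⟨⟨fun x => ?_, fun x y h => ?_, fun x y h => ?_⟩, fun v hv => ?_, ?_⟩
    · have := h1.le x
      split_ifs <;> omega
    · have := h1.weak x y h
      have := h1.le x
      have := h1.le y
      split_ifs <;> omega
    · have := h1.strict x y h
      have := h1.le x
      have := h1.le y
      split_ifs <;> omega
    · rcases Nat.lt_succ_iff_lt_or_eq.1 hv with hv | rfl
      · rw [Function.update_of_ne hv.ne, ← h2 v hv]
        unfold mult
        congr 1
        ext x
        simp only [Finset.mem_filter, Finset.mem_univ, true_and]
        split_ifs <;> omega
      · rw [Function.update_self, mult_eq_zero]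
        intro x
        split_ifs <;> omega
    · rw [← h3]
      unfold mult
      congr 1
      ext x
      have := h1.le x
      simp only [Finset.mem_filter, Finset.mem_univ, true_and]
      split_ifs <;> omega
  · intro T hT
    rw [mem_superTableaux] at hT ⊢
    obtain ⟨h1, h2, h3⟩ := hT
    have hq : ∀ x, T x ≠ q := by
      have := h2 q (by omega)
      rw [Function.update_self, mult_eq_zero] at this
      exact this
    refine ⟨⟨fun x => ?_, fun x y h => ?_, fun x y h => ?_⟩, fun v hv => ?_, ?_⟩
    · have := h1.le x
      split_ifs <;> omega
    · have := h1.weak x y h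
      have := h1.le x
      have := h1.le y
      have := hq x
      have := hq y
      split_ifs <;> omega
    · have := h1.strict x y h
      have := h1.le x
      have := h1.le y
      have := hq x
      have := hq y
      split_ifs <;> omega
    · have h4 := h2 v (by omega)
      rw [Function.update_of_ne hv.ne] at h4
      rw [← h4]
      unfold mult
      congr 1
      ext x
      simp only [Finset.mem_filter, Finset.mem_univ, true_and]
      split_ifs <;> omega
    · rw [← h3]
      unfold mult
      congr 1
      ext x
      have := hq x
      simp only [Finset.mem_filter, Finset.mem_univ, true_and]
      split_ifs <;> omega
  · intro T hT
    rw [mem_superTableaux] at hT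
    ext x
    have := hT.1.le x
    dsimp only; split_ifs <;> omega
  · intro T hT
    rw [mem_superTableaux] at hT
    obtain ⟨h1, h2, h3⟩ := hT
    have hq : ∀ x, T x ≠ q := by
      have := h2 q (by omega)
      rw [Function.update_self, mult_eq_zero] at this
      exact this
    ext x
    have := hq x
    dsimp only; split_ifs <;> omega

/-! ### Super tableau counts as linear functionals of the generating polynomial. -/

open Classical in
/-- The generating polynomial of the fillings that weakly increase along `W` and strictly
increase along `S`. -/
noncomputable def fillingPoly (N : ℕ) (W S : X → X → Prop) : MvPolynomial (Fin N) ℚ :=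
  ∑ T : X → Fin N with (∀ x y, W x y → T x ≤ T y) ∧ (∀ x y, S x y → T x < T y),
    ∏ x, MvPolynomial.X (T x)

open Classical in
theorem prod_X_eq_monomial {N : ℕ} (T : X → Fin N) :
    ∏ x, (MvPolynomial.X (T x) : MvPolynomial (Fin N) ℚ) =
      MvPolynomial.monomial (Finsupp.equivFunOnFinite.symm (mult T)) 1 := by
  have : Finsupp.equivFunOnFinite.symm (mult T) = ∑ x, Finsupp.single (T x) 1 := by
    ext v
    simp [mult, Finsupp.single_apply]
  rw [this, MvPolynomial.monomial_sum_one]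
  rfl

/-- Without odd entries a super tableau is an ordinary filling by values below `q`; this is the base
of the recursion. -/
theorem coeff_fillingPoly (W S : X → X → Prop) {N q : ℕ} (hq : q ≤ N) (c : ℕ → ℕ) :
    (fillingPoly N W S).coeff
      (Finsupp.equivFunOnFinite.symm fun v : Fin N => if (v : ℕ) < q then c v else 0) =
      (superTableaux W S q c 0).card := by
  classical
  simp only [fillingPoly, prod_X_eq_monomial, MvPolynomial.coeff_sum, MvPolynomial.coeff_monomial,
    EmbeddingLike.apply_eq_iff_eq]
  rw [Finset.sum_boole, Finset.filter_filter]
  congr 1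
  refine Finset.card_bij (fun T _ x => (T x : ℕ)) ?_ ?_ ?_
  · intro T hT
    obtain ⟨-, ⟨h1, h2⟩, h3⟩ := Finset.mem_filter.1 hT
    have hlt : ∀ x, (T x : ℕ) < q := by
      intro x
      by_contra hcon
      have h4 := congrFun h3 (T x)
      rw [if_neg hcon, mult_eq_zero] at h4
      exact h4 x rfl
    rw [mem_superTableaux]
    refine ⟨⟨fun x => (hlt x).le, fun x y h => ?_, fun x y h => ?_⟩, fun v hv => ?_, ?_⟩
    · have := hlt x
      have h5 : (T x : ℕ) ≤ T y := h1 x y h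
      omega
    · exact Or.inl (h2 x y h)
    · have h4 := congrFun h3 ⟨v, hv.trans_le hq⟩
      rw [if_pos (by simpa using hv)] at h4
      rw [← h4]
      simp [mult, Fin.ext_iff]
    · rw [mult_eq_zero]
      exact fun x => (hlt x).ne
  · intro T _ T' _ h
    ext x
    exact congrFun h x
  · intro T hT
    rw [mem_superTableaux] at hT
    obtain ⟨h1, h2, h3⟩ := hT
    have hlt : ∀ x, T x < q := by
      rw [mult_eq_zero] at h3
      exact fun x => lt_of_le_of_ne (h1.le x) (h3 x)
    refine ⟨fun x => ⟨T x, (hlt x).trans_le hq⟩, ?_, rfl⟩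
    rw [Finset.mem_filter]
    refine ⟨Finset.mem_univ _, ⟨fun x y h => ?_, fun x y h => ?_⟩, ?_⟩
    · have := h1.weak x y h
      rw [Fin.mk_le_mk]; omega
    · have := h1.strict x y h
      have := hlt x
      rw [Fin.mk_lt_mk]; omega
    · ext v
      split_ifs with hv
      · rw [← h2 v hv]
        simp [mult, Fin.ext_iff]
      · rw [mult_eq_zero]
        intro x h
        rw [← h] at hv
        exact hv (hlt x)

end Fillings

/-- The number of super tableaux of given content is a linear functional of the generating
polynomial of the ordinary fillings. -/
theorem exists_linearMap_eq_card_superTableaux (N i : ℕ) : ∀ (q : ℕ) (c : ℕ → ℕ), q + i ≤ N →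
    ∃ Λ : MvPolynomial (Fin N) ℚ →ₗ[ℚ] ℚ, ∀ (X : Type) [Fintype X] (W S : X → X → Prop),
      HasCorners W S i → Λ (fillingPoly N W S) = (superTableaux W S q c i).card := by
  -- The recursion is `e_i = ∑_{j<i} (-1)^j h_{j+1} e_{i-j-1}`. Each step adds one ordinary value
  -- and removes at least one odd entry, so `q + i` never grows. The functional is fixed before the
  -- shape, so it can be compared on different shapes.
  induction i using Nat.strong_induction_on with
  | _ i ih =>
    intro q c hN
    rcases Nat.eq_zero_or_pos i with rfl | hi
    · exact ⟨MvPolynomial.lcoeff ℚ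
        (Finsupp.equivFunOnFinite.symm fun v : Fin N => if (v : ℕ) < q then c v else 0),
        fun X _ W S _ => coeff_fillingPoly W S hN c⟩
    · have h : ∀ j : ℕ, ∃ Λ : MvPolynomial (Fin N) ℚ →ₗ[ℚ] ℚ, j < i →
          ∀ (X : Type) [Fintype X] (W S : X → X → Prop), HasCorners W S i →
          Λ (fillingPoly N W S) =
            (superTableaux W S (q + 1) (Function.update c q (j + 1)) (i - (j + 1))).card := by
        intro j
        by_cases hj : j < i
        · obtain ⟨Λ, hΛ⟩ := ih (i - (j + 1)) (by omega) (q + 1) (Function.update c q (j + 1))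
            (by omega)
          exact ⟨Λ, fun _ X _ W S hX => hΛ X W S (hX.mono (by omega))⟩
        · exact ⟨0, fun h => absurd h hj⟩
      choose Λ hΛ using h
      refine ⟨∑ j ∈ Finset.range i, (-1 : ℚ) ^ j • Λ j, fun X _ W S hX => ?_⟩
      have h0 := sum_neg_one_pow_mul_card_superTableaux hX hi q c
      rw [Finset.sum_range_succ', Nat.sub_zero, card_superTableaux_update_zero, pow_zero, one_mul]
        at h0
      rw [LinearMap.sum_apply, eq_comm, ← sub_eq_zero, ← h0, add_comm, sub_eq_add_neg,
        ← Finset.sum_neg_distrib]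
      congr 1
      refine Finset.sum_congr rfl fun j hj => ?_
      rw [LinearMap.smul_apply, hΛ j (Finset.mem_range.1 hj) X W S hX, smul_eq_mul, pow_succ]
      ring

/-- The toggle is injective and changes the number of odd entries by exactly one. With no odd entry
it can only add one, whence the separate case `i = 0`. -/
theorem card_superTableaux_le {X : Type} [Fintype X] {W S : X → X → Prop} {n : ℕ}
    (hX : HasCorners W S n) (hn : 0 < n) (q : ℕ) (c : ℕ → ℕ) {i : ℕ} (hi : i ≤ n) :
    (superTableaux W S (q + 1) (Function.update c q (n - i)) i).card ≤
      (superTableaux W S (q + 1) (Function.update c q (n - (i + 1))) (i + 1)).card +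
      if i = 0 then 0 else
        (superTableaux W S (q + 1) (Function.update c q (n - (i - 1))) (i - 1)).card := by
  classical
  obtain ⟨τ, hτ⟩ := exists_toggle hX hn q
  have hsum : ∀ T ∈ superTableaux W S (q + 1) (Function.update c q (n - i)) i,
      mult T q = n - i ∧ mult T q + mult T (q + 1) = n := by
    intro T hT
    rw [mem_superTableaux] at hT
    have h1 := hT.2.1 q (by omega)
    rw [Function.update_self] at h1
    have := hT.2.2
    omega
  have hle := Finset.card_le_card_of_injOn
    (s := superTableaux W S (q + 1) (Function.update c q (n - i)) i)
    (t := superTableaux W S (q + 1) (Function.update c q (n - (i + 1))) (i + 1) ∪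
      if i = 0 then ∅ else
        superTableaux W S (q + 1) (Function.update c q (n - (i - 1))) (i - 1)) τ ?_ ?_
  · refine hle.trans ((Finset.card_union_le _ _).trans (Nat.add_le_add_left ?_ _))
    split_ifs <;> simp
  · intro T hT
    rw [Finset.mem_coe] at hT
    obtain ⟨hq, hs⟩ := hsum T hT
    rw [mem_superTableaux] at hT
    obtain ⟨h1, -, h3, h4⟩ := hτ T hT.1 hs
    have hother : ∀ v < q, mult (τ T) v = c v := fun v hv => by
      rw [h3 v hv, hT.2.1 v (by omega), Function.update_of_ne hv.ne]
    rw [Finset.mem_coe, Finset.mem_union]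
    rcases h4 with h4 | h4
    · left
      rw [mem_superTableaux]
      refine ⟨h1, fun v hv => ?_, by omega⟩
      rcases Nat.lt_succ_iff_lt_or_eq.1 hv with hv | rfl
      · rw [Function.update_of_ne hv.ne, hother v hv]
      · rw [Function.update_self]; omega
    · right
      rw [if_neg (by omega), mem_superTableaux]
      refine ⟨h1, fun v hv => ?_, by omega⟩
      rcases Nat.lt_succ_iff_lt_or_eq.1 hv with hv | rfl
      · rw [Function.update_of_ne hv.ne, hother v hv]
      · rw [Function.update_self]; omega
  · intro T hT T' hT' h
    rw [Finset.mem_coe] at hT hT'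
    have hs := (hsum T hT).2
    have hs' := (hsum T' hT').2
    rw [mem_superTableaux] at hT hT'
    rw [← (hτ T hT.1 hs).2.1, h, (hτ T' hT'.1 hs').2.1]

/-! ### Schur polynomials and the obstruction to positivity. -/

theorem schur_eq_fillingPoly (N : ℕ) (lam : YoungDiagram) :
    schur N lam = fillingPoly N
      (fun p q : {p // p ∈ lam.cells} => p.1.1 = q.1.1 ∧ p.1.2 < q.1.2)
      (fun p q : {p // p ∈ lam.cells} => p.1.2 = q.1.2 ∧ p.1.1 < q.1.1) := by
  unfold schur fillingPoly
  rw [Finset.sum_filter, Finset.sum_filter]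
  congr! 2
  simp only [IsYoungTableau, and_imp]

/-- The last box in the first row that meets `J` is a corner, whatever the size of `J`. -/
theorem hasCorners_youngDiagram (lam : YoungDiagram) (i : ℕ) :
    HasCorners (fun p q : {p // p ∈ lam.cells} => p.1.1 = q.1.1 ∧ p.1.2 < q.1.2)
      (fun p q : {p // p ∈ lam.cells} => p.1.2 = q.1.2 ∧ p.1.1 < q.1.1) i := by
  intro J _ hJ _
  obtain ⟨x, hx, hmin⟩ := J.exists_min_image (fun p => p.1.1) hJ
  obtain ⟨y, hy, hmax⟩ := (J.filter fun p => p.1.1 = x.1.1).exists_max_image (fun p => p.1.2)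
    ⟨x, by simp [hx]⟩
  rw [Finset.mem_filter] at hy
  refine ⟨y, hy.1, fun z hz => ⟨fun h => ?_, fun h => ?_⟩⟩
  · have := hmax z (by rw [Finset.mem_filter]; exact ⟨hz, by omega⟩)
    omega
  · have := hmin z hz
    omega

/-- A generating polynomial is not Schur-positive if the number of super tableaux with `i` odd
entries in the last `n` boxes is positive, whereas it vanishes for `i - 1` and `i + 1`. -/
theorem not_isSchurPositive_fillingPoly {X : Type} [Fintype X] {W S : X → X → Prop}
    {N q n i : ℕ} (hn : i < n) (hN : q + 1 + (i + 1) ≤ N) (hX : HasCorners W S (i + 1))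
    (c : ℕ → ℕ)
    (hpos : (superTableaux W S (q + 1) (Function.update c q (n - i)) i).Nonempty)
    (hzero : ∀ j ≠ i, superTableaux W S (q + 1) (Function.update c q (n - j)) j = ∅) :
    ¬ IsSchurPositive (fillingPoly N W S) := by
  rintro ⟨a, ha, hf⟩
  obtain ⟨Λ, hΛ⟩ := exists_linearMap_eq_card_superTableaux N i (q + 1)
    (Function.update c q (n - i)) (by omega)
  obtain ⟨Λ', hΛ'⟩ := exists_linearMap_eq_card_superTableaux N (i + 1) (q + 1)
    (Function.update c q (n - (i + 1))) (by omega)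
  obtain ⟨Λ'', hΛ''⟩ := exists_linearMap_eq_card_superTableaux N (i - 1) (q + 1)
    (Function.update c q (n - (i - 1))) (by omega)
  -- `Φ` is nonpositive on every Schur polynomial but positive on the given one.
  let Φ : MvPolynomial (Fin N) ℚ →ₗ[ℚ] ℚ := Λ - (Λ' + if i = 0 then 0 else Λ'')
  have hschur : ∀ lam, Φ (schur N lam) ≤ 0 := by
    intro lam
    have hL := hasCorners_youngDiagram lam
    have hle := card_superTableaux_le (hL n) (by omega) q c hn.le
    rw [schur_eq_fillingPoly]
    simp only [Φ, LinearMap.sub_apply, LinearMap.add_apply, sub_nonpos, hΛ _ _ _ (hL i),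
      hΛ' _ _ _ (hL (i + 1))]
    split_ifs with h0
    · rw [if_pos h0] at hle
      rw [LinearMap.zero_apply]
      exact_mod_cast hle
    · rw [if_neg h0] at hle
      rw [hΛ'' _ _ _ (hL (i - 1))]
      exact_mod_cast hle
  have hle : Φ (fillingPoly N W S) ≤ 0 := by
    rw [hf, Finsupp.sum, map_sum]
    refine Finset.sum_nonpos fun lam _ => ?_
    rw [map_smul, smul_eq_mul]
    exact mul_nonpos_of_nonneg_of_nonpos (ha lam) (hschur lam)
  simp only [Φ, LinearMap.sub_apply, LinearMap.add_apply, sub_nonpos,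
    hΛ _ _ _ (hX.mono (Nat.le_succ i)), hΛ' _ _ _ hX, hzero (i + 1) (by omega)] at hle
  have hpos' := Finset.card_pos.2 hpos
  split_ifs at hle with h0
  · simp only [Finset.card_empty, LinearMap.zero_apply] at hle
    norm_cast at hle
    omega
  · rw [hΛ'' _ _ _ (hX.mono (by omega)), hzero (i - 1) (by omega)] at hle
    simp only [Finset.card_empty] at hle
    norm_cast at hle
    omega

/-! ### Boxes of the cylinder and shapes isomorphic to skew shapes. -/

section Cylinder

variable {v u : ℕ}

theorem box_add_box (i j i' j' : ℤ) :
    box v u i j + box v u i' j' = box v u (i + i') (j + j') :=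
  rfl

theorem box_eq_box_iff {i j i' j' : ℤ} :
    box v u i j = box v u i' j' ↔ ∃ a : ℤ, i' = i - a * u ∧ j' = j + a * v := by
  unfold box
  rw [QuotientAddGroup.eq, AddSubgroup.mem_zmultiples_iff]
  refine exists_congr fun a => ?_
  simp only [Prod.smul_mk, smul_eq_mul, Prod.neg_mk, Prod.mk_add_mk, Prod.mk.injEq]
  constructor
  · rintro ⟨h1, h2⟩
    constructor <;> linarith
  · rintro ⟨h1, h2⟩
    constructor <;> linarith

theorem exists_box_eq (x : Cylinder v u) : ∃ i j, box v u i j = x := by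
  obtain ⟨⟨i, j⟩, h⟩ := QuotientAddGroup.mk_surjective x
  exact ⟨i, j, h⟩

theorem exists_box_of_le {i j : ℤ} {y : Cylinder v u} (h : Le (box v u i j) y) :
    ∃ i' j', box v u i' j' = y ∧ i ≤ i' ∧ j ≤ j' := by
  obtain ⟨i₀, j₀, i', j', h0, rfl, hi, hj⟩ := h
  obtain ⟨a, rfl, rfl⟩ := box_eq_box_iff.1 h0
  exact ⟨i' - a * u, j' + a * v, (box_eq_box_iff.2 ⟨a, rfl, rfl⟩).symm, by linarith, by linarith⟩

theorem exists_box_of_strictBelow {i j : ℤ} {y : Cylinder v u}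
    (h : StrictBelow (box v u i j) y) :
    ∃ i' j', box v u i' j' = y ∧ i ≤ i' ∧ j < j' := by
  obtain ⟨i₀, j₀, i', j', h0, rfl, hi, hj⟩ := h
  obtain ⟨a, rfl, rfl⟩ := box_eq_box_iff.1 h0
  exact ⟨i' - a * u, j' + a * v, (box_eq_box_iff.2 ⟨a, rfl, rfl⟩).symm, by linarith, by linarith⟩

theorem IsCylindricSkewShape.box_mem {C : Finset (Cylinder v u)} (hC : IsCylindricSkewShape C)
    {i j i' j' a b : ℤ} (h : box v u i j ∈ C) (h' : box v u i' j' ∈ C) (h1 : i ≤ a) (h2 : a ≤ i')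
    (h3 : j ≤ b) (h4 : b ≤ j') : box v u a b ∈ C :=
  hC _ h _ h' _ ⟨i, j, a, b, rfl, rfl, h1, h3⟩ ⟨a, b, i', j', rfl, rfl, h2, h4⟩

/-- A finite set of boxes that embeds in `ℤ²` as a convex set is isomorphic to a skew shape. -/
theorem isIsomorphicToSkewShape_of_embedding {C : Finset (Cylinder v u)}
    (g : Cylinder v u → ℤ × ℤ) (hinj : ∀ x ∈ C, ∀ y ∈ C, g x = g y → x = y)
    (hle : ∀ x ∈ C, ∀ y ∈ C, Le x y ↔ (g x).1 ≤ (g y).1 ∧ (g x).2 ≤ (g y).2)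
    (hst : ∀ x ∈ C, ∀ y ∈ C, StrictBelow x y ↔ (g x).1 ≤ (g y).1 ∧ (g x).2 < (g y).2)
    (hconv : ∀ x ∈ C, ∀ z ∈ C, ∀ a b, (g x).1 ≤ a → a ≤ (g z).1 → (g x).2 ≤ b → b ≤ (g z).2 →
      ∃ y ∈ C, g y = (a, b)) :
    IsIsomorphicToSkewShape C := by
  classical
  obtain ⟨a₀, ha⟩ := (C.image fun x => (g x).1).bddBelow
  obtain ⟨b₀, hb⟩ := (C.image fun x => (g x).2).bddBelow
  have ha' : ∀ x ∈ C, a₀ ≤ (g x).1 := fun x hx => ha (by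
    rw [Finset.mem_coe]; exact Finset.mem_image_of_mem (fun x => (g x).1) hx)
  have hb' : ∀ x ∈ C, b₀ ≤ (g x).2 := fun x hx => hb (by
    rw [Finset.mem_coe]; exact Finset.mem_image_of_mem (fun x => (g x).2) hx)
  -- The coordinates are swapped because cells of a Young diagram list the row first.
  let f : Cylinder v u → ℕ × ℕ := fun x => (((g x).2 - b₀).toNat, ((g x).1 - a₀).toNat)
  have hf1 : ∀ x ∈ C, ((f x).1 : ℤ) = (g x).2 - b₀ := fun x hx =>
    Int.toNat_of_nonneg (sub_nonneg.2 (hb' x hx))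
  have hf2 : ∀ x ∈ C, ((f x).2 : ℤ) = (g x).1 - a₀ := fun x hx =>
    Int.toNat_of_nonneg (sub_nonneg.2 (ha' x hx))
  let P : Finset (ℕ × ℕ) := C.image f
  let lam : YoungDiagram :=
    { cells := P.biUnion fun p => Finset.Iic p
      isLowerSet := by
        intro p q hqp hp
        simp only [Finset.coe_biUnion, Set.mem_iUnion, Finset.coe_Iic, Set.mem_Iic] at hp ⊢
        obtain ⟨r, hr, hpr⟩ := hp
        exact ⟨r, hr, hqp.trans hpr⟩ }
  have hPlam : P ⊆ lam.cells := fun p hp =>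
    Finset.mem_biUnion.2 ⟨p, hp, Finset.mem_Iic.2 le_rfl⟩
  -- The complement of `P` in its lower closure is itself a lower set, because `P` is convex.
  let mu : YoungDiagram :=
    { cells := lam.cells \ P
      isLowerSet := by
        intro p q hqp hp
        rw [Finset.mem_coe, Finset.mem_sdiff] at hp ⊢
        refine ⟨lam.isLowerSet hqp hp.1, fun hq => hp.2 ?_⟩
        obtain ⟨x, hx, rfl⟩ := Finset.mem_image.1 hq
        obtain ⟨r, hr, hpr⟩ := Finset.mem_biUnion.1 hp.1
        obtain ⟨z, hz, rfl⟩ := Finset.mem_image.1 hr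
        rw [Finset.mem_Iic] at hpr
        have h1 := hqp.1
        have h2 := hqp.2
        have h3 := hpr.1
        have h4 := hpr.2
        have := hf1 x hx
        have := hf2 x hx
        have := hf1 z hz
        have := hf2 z hz
        obtain ⟨y, hy, hgy⟩ := hconv x hx z hz (p.2 + a₀) (p.1 + b₀) (by omega) (by omega)
          (by omega) (by omega)
        refine Finset.mem_image.2 ⟨y, hy, ?_⟩
        have := hf1 y hy
        have := hf2 y hy
        rw [hgy] at *
        ext <;> omega }
  have hsdiff : lam.cells \ mu.cells = P := Finset.sdiff_sdiff_eq_self hPlam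
  have hmem : ∀ x : {x // x ∈ C}, f x.1 ∈ lam.cells \ mu.cells := fun x => by
    rw [hsdiff]; exact Finset.mem_image_of_mem f x.2
  obtain ⟨e, he⟩ : ∃ e : {x // x ∈ C} ≃ {p : ℕ × ℕ // p ∈ lam.cells \ mu.cells},
      ∀ x, (e x).1 = f x.1 := by
    refine ⟨Equiv.ofBijective (fun x => ⟨f x.1, hmem x⟩) ⟨?_, ?_⟩, fun x => rfl⟩
    · intro x y h
      have h' : f x.1 = f y.1 := congrArg Subtype.val h
      have h1 := hf1 x x.2
      have h2 := hf2 x x.2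
      have h3 := hf1 y y.2
      have h4 := hf2 y y.2
      rw [h'] at h1 h2
      exact Subtype.ext (hinj x x.2 y y.2 (Prod.ext (by omega) (by omega)))
    · rintro ⟨p, hp⟩
      rw [hsdiff] at hp
      obtain ⟨x, hx, h⟩ := Finset.mem_image.1 hp
      exact ⟨⟨x, hx⟩, Subtype.ext h⟩
  refine ⟨lam, mu, Finset.sdiff_subset, e, fun x y => ?_, fun x y => ?_⟩
  all_goals
    have h1 := hf1 x x.2
    have h2 := hf2 x x.2
    have h3 := hf1 y y.2
    have h4 := hf2 y y.2
    rw [he, he]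
  · rw [hle x x.2 y y.2]
    omega
  · rw [hst x x.2 y y.2]
    omega

/-- On a cylinder with one column, every cylindric skew shape is a single column. -/
theorem isIsomorphicToSkewShape_of_one_column {C : Finset (Cylinder v u)} (hu : u = 1)
    (hC : IsCylindricSkewShape C) : IsIsomorphicToSkewShape C := by
  subst hu
  -- A step to the right amounts to `v` steps up in the only column.
  have hcol : ∀ i j : ℤ, box v 1 i j = box v 1 0 (j + i * v) := fun i j =>
    box_eq_box_iff.2 ⟨i, by simp, rfl⟩
  have hrep : ∀ x : Cylinder v 1, ∃ j, box v 1 0 j = x := fun x => by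
    obtain ⟨i, j, rfl⟩ := exists_box_eq x
    exact ⟨_, (hcol i j).symm⟩
  choose g hg using hrep
  have hgbox : ∀ i j : ℤ, g (box v 1 i j) = j + i * v := by
    intro i j
    obtain ⟨a, h1, h2⟩ := box_eq_box_iff.1 (hg (box v 1 i j))
    have ha : a = -i := by push_cast at h1; linarith
    rw [ha] at h2
    linarith
  refine isIsomorphicToSkewShape_of_embedding (fun x => (0, g x)) ?_ ?_ ?_ ?_
  · intro x _ y _ h
    have h' : g x = g y := congrArg Prod.snd h
    rw [← hg x, h', hg y]
  · intro x _ y _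
    simp only [le_refl, true_and]
    constructor
    · rintro ⟨i, j, i', j', rfl, rfl, hi, hj⟩
      rw [hgbox, hgbox]
      have := mul_le_mul_of_nonneg_right hi (Int.natCast_nonneg v)
      linarith
    · exact fun h => ⟨0, g x, 0, g y, hg x, hg y, le_rfl, h⟩
  · intro x _ y _
    simp only [le_refl, true_and]
    constructor
    · rintro ⟨i, j, i', j', rfl, rfl, hi, hj⟩
      rw [hgbox, hgbox]
      have := mul_le_mul_of_nonneg_right hi (Int.natCast_nonneg v)
      linarith
    · exact fun h => ⟨0, g x, 0, g y, hg x, hg y, le_rfl, h⟩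
  · intro x hx z hz a b h1 h2 h3 h4
    refine ⟨box v 1 0 b, hC.box_mem (i := 0) (j := g x) (i' := 0) (j' := g z) ?_ ?_ le_rfl le_rfl
      h3 h4, ?_⟩
    · rwa [hg]
    · rwa [hg]
    · rw [hgbox]
      ext
      · exact le_antisymm h1 h2
      · simp

/-- A cylindric skew shape that misses a diagonal is isomorphic to a skew shape. -/
theorem isIsomorphicToSkewShape_of_missing_diagonal {C : Finset (Cylinder v u)}
    (hC : IsCylindricSkewShape C) (hpos : 0 < v + u) (d : ℤ)
    (hd : ∀ i j : ℤ, box v u i j ∈ C → ¬ ((v + u : ℕ) : ℤ) ∣ i - j - d) :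
    IsIsomorphicToSkewShape C := by
  set n : ℤ := ((v + u : ℕ) : ℤ) with hn
  have hn0 : 0 < n := by rw [hn]; exact_mod_cast hpos
  have hnvu : n = v + u := by rw [hn]; push_cast; rfl
  -- Cutting along the missing diagonal unrolls the cylinder into a strip of `ℤ²`.
  have hrep : ∀ x : Cylinder v u, ∃ p : ℤ × ℤ, box v u p.1 p.2 = x ∧ d ≤ p.1 - p.2 ∧
      p.1 - p.2 < d + n := by
    intro x
    obtain ⟨i, j, rfl⟩ := exists_box_eq x
    refine ⟨(i - (i - j - d) / n * u, j + (i - j - d) / n * v),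
      (box_eq_box_iff.2 ⟨_, rfl, rfl⟩).symm, ?_⟩
    have h1 := Int.emod_nonneg (i - j - d) hn0.ne'
    have h2 := Int.emod_lt_of_pos (i - j - d) hn0
    rw [Int.emod_def] at h1 h2
    have h3 : n * ((i - j - d) / n) = (i - j - d) / n * v + (i - j - d) / n * u := by
      rw [hnvu]; ring
    dsimp only
    constructor <;> linarith
  choose g hg hg1 hg2 using hrep
  have hne : ∀ i j : ℤ, box v u i j ∈ C → i - j ≠ d ∧ i - j ≠ d + n := by
    intro i j h
    have := hd i j h
    constructor
    · intro h'
      exact this (by rw [h', sub_self]; exact dvd_zero n)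
    · intro h'
      exact this (by rw [h', add_sub_cancel_left])
  have hmemg : ∀ x ∈ C, box v u (g x).1 (g x).2 ∈ C := fun x hx => by rwa [hg]
  -- By convexity, two comparable boxes on different sides of the cut would force a box of `C` onto
  -- the missing diagonal.
  have hstrip : ∀ i j i' j' : ℤ, box v u i j ∈ C → box v u i' j' ∈ C → i ≤ i' → j ≤ j' →
      d ≤ i - j → i - j < d + n → d < i' - j' ∧ i' - j' < d + n := by
    intro i j i' j' h h' hi hj h1 h2
    constructor
    · by_contra hcon
      exact (hne i (i - d) (hC.box_mem h h' le_rfl hi (by linarith) (by linarith))).1 (by ring)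
    · by_contra hcon
      exact (hne (j + d + n) j (hC.box_mem h h' (by linarith) (by linarith) le_rfl hj)).2 (by ring)
  have huniq : ∀ i j : ℤ, d ≤ i - j → i - j < d + n → g (box v u i j) = (i, j) := by
    intro i j h1 h2
    obtain ⟨a, ha1, ha2⟩ := box_eq_box_iff.1 (hg (box v u i j))
    have h3 := hg1 (box v u i j)
    have h4 := hg2 (box v u i j)
    generalize g (box v u i j) = p at *
    have h5 : i - j = p.1 - p.2 - a * n := by
      rw [ha1, ha2, hnvu]; ring
    have ha : a = 0 := by
      rcases lt_trichotomy a 0 with h | h | h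
      · have : a * n ≤ -1 * n := mul_le_mul_of_nonneg_right (by omega) hn0.le
        linarith
      · exact h
      · have : 1 * n ≤ a * n := mul_le_mul_of_nonneg_right (by omega) hn0.le
        linarith
    subst ha
    ext
    · simpa using ha1.symm
    · simpa using ha2.symm
  refine isIsomorphicToSkewShape_of_embedding g ?_ ?_ ?_ ?_
  · intro x _ y _ h
    rw [← hg x, h, hg y]
  · intro x hx y hy
    constructor
    · intro h
      rw [← hg x] at h
      obtain ⟨i', j', rfl, hi, hj⟩ := exists_box_of_le h
      have h' := hstrip _ _ _ _ (hmemg x hx) hy hi hj (hg1 x) (hg2 x)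
      rw [huniq i' j' h'.1.le h'.2]
      exact ⟨hi, hj⟩
    · exact fun h => ⟨_, _, _, _, hg x, hg y, h.1, h.2⟩
  · intro x hx y hy
    constructor
    · intro h
      rw [← hg x] at h
      obtain ⟨i', j', rfl, hi, hj⟩ := exists_box_of_strictBelow h
      have h' := hstrip _ _ _ _ (hmemg x hx) hy hi hj.le (hg1 x) (hg2 x)
      rw [huniq i' j' h'.1.le h'.2]
      exact ⟨hi, hj⟩
    · exact fun h => ⟨_, _, _, _, hg x, hg y, h.1, h.2⟩
  · intro x hx z hz a b h1 h2 h3 h4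
    have hab := hC.box_mem (hmemg x hx) (hmemg z hz) h1 h2 h3 h4
    have h' := hstrip _ _ _ _ (hmemg x hx) hab h1 h3 (hg1 x) (hg2 x)
    exact ⟨_, hab, huniq a b h'.1.le h'.2⟩

end Cylinder

/-! ### Diagonals, corners on the cylinder, row ends and the top ribbon. -/

section Loop

variable {v u : ℕ}

/-- The diagonal `i - j` of the box `⟨i, j⟩`, modulo the number of diagonals. -/
def diagonal (v u : ℕ) : Cylinder v u →+ ZMod (v + u) :=
  QuotientAddGroup.lift _
    ((Int.castAddHom (ZMod (v + u))).comp (AddMonoidHom.fst ℤ ℤ - AddMonoidHom.snd ℤ ℤ)) (by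
      rw [AddSubgroup.zmultiples_le, AddMonoidHom.mem_ker]
      have h : ((v + u : ℕ) : ZMod (v + u)) = 0 := ZMod.natCast_self _
      push_cast at h
      simp only [AddMonoidHom.comp_apply, AddMonoidHom.sub_apply, AddMonoidHom.coe_fst,
        AddMonoidHom.coe_snd, Int.coe_castAddHom, Int.cast_sub, Int.cast_neg, Int.cast_natCast]
      linear_combination -h)

/-- The row `j` of the box `⟨i, j⟩`, modulo the number of rows. -/
def rowIndex (v u : ℕ) : Cylinder v u →+ ZMod v :=
  QuotientAddGroup.lift _ ((Int.castAddHom (ZMod v)).comp (AddMonoidHom.snd ℤ ℤ)) (by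
      rw [AddSubgroup.zmultiples_le, AddMonoidHom.mem_ker]
      simp)

theorem diagonal_box (i j : ℤ) : diagonal v u (box v u i j) = ((i - j : ℤ) : ZMod (v + u)) :=
  rfl

theorem rowIndex_box (i j : ℤ) : rowIndex v u (box v u i j) = ((j : ℤ) : ZMod v) :=
  rfl

theorem exists_box_of_diagonal_eq {i j : ℤ} {y : Cylinder v u}
    (h : diagonal v u (box v u i j) = diagonal v u y) :
    ∃ t : ℤ, y = box v u (i + t) (j + t) := by
  obtain ⟨i', j', rfl⟩ := exists_box_eq y
  rw [diagonal_box, diagonal_box, ZMod.intCast_eq_intCast_iff_dvd_sub] at h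
  obtain ⟨a, ha⟩ := h
  push_cast at ha
  refine ⟨i' + a * -u - i, box_eq_box_iff.2 ⟨a, by ring, by linear_combination ha⟩⟩

theorem exists_box_of_rowIndex_eq {i j : ℤ} {y : Cylinder v u}
    (h : rowIndex v u (box v u i j) = rowIndex v u y) :
    ∃ t : ℤ, y = box v u (i + t) j := by
  obtain ⟨i', j', rfl⟩ := exists_box_eq y
  rw [rowIndex_box, rowIndex_box, ZMod.intCast_eq_intCast_iff_dvd_sub] at h
  obtain ⟨a, ha⟩ := h
  refine ⟨i' + a * u - i, box_eq_box_iff.2 ⟨-a, by ring, by linear_combination -ha⟩⟩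

/-- `x` lies strictly to the left of `y` in the same row. -/
def LeftOf (x y : Cylinder v u) : Prop :=
  ∃ i i' j : ℤ, box v u i j = x ∧ box v u i' j = y ∧ i < i'

/-- `x` lies strictly below `y` in the same column. -/
def Below (x y : Cylinder v u) : Prop :=
  ∃ i j j' : ℤ, box v u i j = x ∧ box v u i j' = y ∧ j < j'

theorem exists_box_of_below {i j : ℤ} {y : Cylinder v u} (h : Below y (box v u i j)) :
    ∃ j' : ℤ, y = box v u i j' ∧ j' < j := by
  obtain ⟨i₀, j₀, j', rfl, h0, hj⟩ := h
  obtain ⟨a, rfl, rfl⟩ := box_eq_box_iff.1 h0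
  exact ⟨j₀ + a * v, box_eq_box_iff.2 ⟨a, rfl, rfl⟩, by linarith⟩

theorem not_below_self (hu : 0 < u) (x : Cylinder v u) : ¬ Below x x := by
  obtain ⟨i, j, rfl⟩ := exists_box_eq x
  intro h
  obtain ⟨j', h1, h2⟩ := exists_box_of_below h
  obtain ⟨a, ha, hb⟩ := box_eq_box_iff.1 h1
  have hu' : (u : ℤ) ≠ 0 := by exact_mod_cast hu.ne'
  have : a = 0 := by
    have : a * (u : ℤ) = 0 := by linarith
    exact (mul_eq_zero.1 this).resolve_right hu'
  subst this
  simp at hb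
  omega

variable (C : Finset (Cylinder v u))

theorem cylindricSchur_eq_fillingPoly (N : ℕ) :
    cylindricSchur N C = fillingPoly N (fun x y : {x // x ∈ C} => LeftOf x.1 y.1)
      (fun x y : {x // x ∈ C} => Below x.1 y.1) := by
  unfold cylindricSchur fillingPoly
  rw [Finset.sum_filter, Finset.sum_filter]
  congr! 2
  constructor
  · rintro ⟨h1, h2⟩
    constructor
    · rintro ⟨_, hx⟩ ⟨_, hy⟩ ⟨i, i', j, rfl, rfl, h⟩
      exact h1 i i' j hx hy h
    · rintro ⟨_, hx⟩ ⟨_, hy⟩ ⟨i, j, j', rfl, rfl, h⟩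
      exact h2 i j j' hx hy h
  · rintro ⟨h1, h2⟩
    exact ⟨fun i i' j hx hy h => h1 _ _ ⟨i, i', j, rfl, rfl, h⟩,
      fun i j j' hx hy h => h2 _ _ ⟨i, j, j', rfl, rfl, h⟩⟩

variable {C}

/-- Both the right neighbour and the neighbour below a box lie on the next diagonal. An upper set
with fewer than `v + u` boxes has a box whose next diagonal it misses, and that box is a corner. -/
theorem hasCorners_cylinder (hC : IsCylindricSkewShape C) {i : ℕ} (hi : i < v + u) :
    HasCorners (fun x y : {x // x ∈ C} => LeftOf x.1 y.1)
      (fun x y : {x // x ∈ C} => Below x.1 y.1) i := by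
  classical
  intro J hJ hne hcard
  have : NeZero (v + u) := ⟨by omega⟩
  obtain ⟨x, hx, hnext⟩ : ∃ x ∈ J, ∀ y ∈ J, diagonal v u y.1 ≠ diagonal v u x.1 + 1 := by
    by_contra! hcon
    obtain ⟨x₀, hx₀⟩ := hne
    have hall : ∀ t : ℕ, ∃ y ∈ J, diagonal v u y.1 = diagonal v u x₀.1 + t := by
      intro t
      induction t with
      | zero => exact ⟨x₀, hx₀, by simp⟩
      | succ t ih =>
        obtain ⟨y, hy, h⟩ := ih
        obtain ⟨z, hz, h'⟩ := hcon y hy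
        exact ⟨z, hz, by rw [h', h]; push_cast; ring⟩
    have huniv : J.image (fun y => diagonal v u y.1) = Finset.univ := by
      rw [Finset.eq_univ_iff_forall]
      intro d
      obtain ⟨y, hy, h⟩ := hall (d - diagonal v u x₀.1).val
      rw [ZMod.natCast_zmod_val, add_sub_cancel] at h
      exact Finset.mem_image.2 ⟨y, hy, h⟩
    have h1 := Finset.card_image_le (s := J) (f := fun y => diagonal v u y.1)
    rw [huniv, Finset.card_univ, ZMod.card] at h1
    omega
  refine ⟨x, hx, fun y hy => ⟨?_, ?_⟩⟩
  · rintro ⟨i, i', j, h1, h2, h⟩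
    have hmem : box v u (i + 1) j ∈ C :=
      hC.box_mem (h1 ▸ x.2) (h2 ▸ y.2) (by omega) (by omega) le_rfl le_rfl
    refine hnext ⟨_, hmem⟩ (hJ x hx _ (Or.inl ⟨i, i + 1, j, h1, rfl, by omega⟩)) ?_
    rw [← h1, diagonal_box, diagonal_box]
    push_cast
    ring
  · rintro ⟨i, j, j', h1, h2, h⟩
    have hmem : box v u i (j' - 1) ∈ C :=
      hC.box_mem (h1 ▸ y.2) (h2 ▸ x.2) le_rfl le_rfl (by omega) (by omega)
    have hJmem : (⟨_, hmem⟩ : {x // x ∈ C}) ∈ J := by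
      rcases (show j ≤ j' - 1 by omega).eq_or_lt with hj | hj
      · have : (⟨_, hmem⟩ : {x // x ∈ C}) = y := Subtype.ext (by
          rw [← h1, hj])
        rwa [this]
      · exact hJ y hy _ (Or.inr ⟨i, j, j' - 1, h1, rfl, hj⟩)
    refine hnext ⟨_, hmem⟩ hJmem ?_
    rw [← h2, diagonal_box, diagonal_box]
    push_cast
    ring

open Classical in
/-- The last boxes of the rows of `C`. -/
noncomputable def rowEnds (C : Finset (Cylinder v u)) : Finset {x // x ∈ C} :=
  Finset.univ.filter fun x => x.1 + box v u 1 0 ∉ C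

open Classical in
/-- The top ribbon of `C`, as a set of elements of `C`. -/
noncomputable def ribbonBoxes (C : Finset (Cylinder v u)) : Finset {x // x ∈ C} :=
  Finset.univ.filter fun x => x.1 + box v u 1 1 ∉ C

theorem mem_rowEnds {x : {x // x ∈ C}} : x ∈ rowEnds C ↔ x.1 + box v u 1 0 ∉ C := by
  simp [rowEnds]

theorem mem_ribbonBoxes {x : {x // x ∈ C}} : x ∈ ribbonBoxes C ↔ x.1 + box v u 1 1 ∉ C := by
  simp [ribbonBoxes]

theorem card_rowEnds_le (hC : IsCylindricSkewShape C) (hv : 0 < v) : (rowEnds C).card ≤ v := by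
  classical
  have : NeZero v := ⟨hv.ne'⟩
  suffices h : Set.InjOn (fun x : {x // x ∈ C} => rowIndex v u x.1) (rowEnds C) by
    calc (rowEnds C).card ≤ (Finset.univ : Finset (ZMod v)).card :=
          Finset.card_le_card_of_injOn _ (fun _ _ => Finset.mem_coe.2 (Finset.mem_univ _)) h
      _ = v := by rw [Finset.card_univ, ZMod.card]
  have key : ∀ (i j t : ℤ), box v u i j ∈ C → box v u (i + t) j ∈ C →
      box v u i j + box v u 1 0 ∉ C → t ≤ 0 := by
    intro i j t h h' hend
    by_contra hcon
    exact hend (hC.box_mem h h' (by omega) (by omega) (by omega) (by omega))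
  rintro ⟨x, hxC⟩ hx ⟨y, hyC⟩ hy hxy
  rw [Finset.mem_coe, mem_rowEnds] at hx hy
  dsimp only at hx hy hxy
  obtain ⟨i, j, rfl⟩ := exists_box_eq x
  obtain ⟨t, rfl⟩ := exists_box_of_rowIndex_eq hxy
  have h1 := key i j t hxC hyC hx
  have h2 := key (i + t) j (-t) hyC (by simpa using hxC) hy
  have ht : t = 0 := by omega
  subst ht
  simp

theorem injOn_diagonal (P : {x // x ∈ C} → Prop)
    (hP : ∀ (i j t : ℤ) (h : box v u i j ∈ C), box v u (i + t) (j + t) ∈ C → 0 < t →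
      ¬ P ⟨_, h⟩) {x y : {x // x ∈ C}} (hx : P x) (hy : P y)
    (hxy : diagonal v u x.1 = diagonal v u y.1) : x = y := by
  obtain ⟨x, hxC⟩ := x
  obtain ⟨y, hyC⟩ := y
  obtain ⟨i, j, rfl⟩ := exists_box_eq x
  obtain ⟨t, rfl⟩ := exists_box_of_diagonal_eq hxy
  rcases lt_trichotomy t 0 with ht | rfl | ht
  · exact absurd hy (hP (i + t) (j + t) (-t) hyC (by simpa using hxC) (by omega))
  · simp
  · exact absurd hx (hP i j t hxC hyC ht)

theorem injOn_diagonal_ribbonBoxes (hC : IsCylindricSkewShape C) :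
    Set.InjOn (fun x : {x // x ∈ C} => diagonal v u x.1) (ribbonBoxes C) := by
  intro x hx y hy hxy
  rw [Finset.mem_coe, mem_ribbonBoxes] at hx hy
  refine injOn_diagonal (fun x => x.1 + box v u 1 1 ∉ C) ?_ hx hy hxy
  intro i j t h h' ht hcon
  exact hcon (hC.box_mem h h' (by omega) (by omega) (by omega) (by omega))

theorem card_ribbonBoxes_le (hC : IsCylindricSkewShape C) (hv : 0 < v) :
    (ribbonBoxes C).card ≤ v + u := by
  classical
  have : NeZero (v + u) := ⟨by omega⟩
  calc (ribbonBoxes C).card ≤ (Finset.univ : Finset (ZMod (v + u))).card :=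
        Finset.card_le_card_of_injOn (fun x => diagonal v u x.1)
          (fun _ _ => Finset.mem_coe.2 (Finset.mem_univ _)) (injOn_diagonal_ribbonBoxes hC)
    _ = v + u := by rw [Finset.card_univ, ZMod.card]

/-- Climbing each diagonal from a box of `C` until just before it leaves `C` ends on the ribbon. -/
theorem le_card_ribbonBoxes (hv : 0 < v)
    (hd : ∀ d : ℤ, ∃ i j : ℤ, box v u i j ∈ C ∧ ((v + u : ℕ) : ℤ) ∣ i - j - d) :
    v + u ≤ (ribbonBoxes C).card := by
  classical
  have : NeZero (v + u) := ⟨by omega⟩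
  have huniv : (ribbonBoxes C).image (fun x => diagonal v u x.1) = Finset.univ := by
    rw [Finset.eq_univ_iff_forall]
    intro d
    obtain ⟨i, j, hij, hdvd⟩ := hd d.val
    have hdij : ((i - j : ℤ) : ZMod (v + u)) = d := by
      have h := (ZMod.intCast_zmod_eq_zero_iff_dvd (i - j - (d.val : ℤ)) (v + u)).2 hdvd
      rw [Int.cast_sub, sub_eq_zero] at h
      rw [h]
      simp
    obtain ⟨t, ht, ht'⟩ : ∃ t : ℕ, box v u (i + t) (j + t) ∈ C ∧
        box v u (i + (t + 1 : ℕ)) (j + (t + 1 : ℕ)) ∉ C := by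
      by_contra! hcon
      have hall : ∀ t : ℕ, box v u (i + t) (j + t) ∈ C := by
        intro t
        induction t with
        | zero => simpa using hij
        | succ t ih => exact hcon t ih
      refine not_injective_infinite_finite
        (fun t : ℕ => (⟨_, hall t⟩ : {x // x ∈ C})) fun s t hst => ?_
      obtain ⟨a, h1, h2⟩ := box_eq_box_iff.1 (congrArg Subtype.val hst)
      have h3 : a * ((v : ℤ) + u) = 0 := by linear_combination h1 - h2
      have h4 : (v : ℤ) + u ≠ 0 := by omega
      have ha := (mul_eq_zero.1 h3).resolve_right h4
      subst ha
      simpa using h2.symm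
    refine Finset.mem_image.2 ⟨⟨_, ht⟩, mem_ribbonBoxes.2 ?_, ?_⟩
    · push_cast at ht'
      rwa [← add_assoc, ← add_assoc] at ht'
    · rw [diagonal_box, ← hdij]
      congr 1
      ring
  have h := Finset.card_image_le (s := ribbonBoxes C) (f := fun x => diagonal v u x.1)
  rwa [huniv, Finset.card_univ, ZMod.card] at h

end Loop

/-! ### Fillings of the closed top ribbon. -/

section Loop

variable {v u : ℕ} {C : Finset (Cylinder v u)}

/-- No two boxes on a common diagonal are filled with the two largest values. -/
theorem IsSuperTableau.lt_of_diagonal (hC : IsCylindricSkewShape C) {m : ℕ}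
    {T : {x // x ∈ C} → ℕ}
    (hT : IsSuperTableau (fun x y : {x // x ∈ C} => LeftOf x.1 y.1)
      (fun x y : {x // x ∈ C} => Below x.1 y.1) (m + 1) T)
    (i j t : ℤ) (h : box v u i j ∈ C) (h' : box v u (i + t) (j + t) ∈ C) (ht : 0 < t) :
    ¬ m ≤ T ⟨_, h⟩ := by
  intro hm
  have h01 : box v u i (j + 1) ∈ C :=
    hC.box_mem h h' (by omega) (by omega) (by omega) (by omega)
  have h11 : box v u (i + 1) (j + 1) ∈ C :=
    hC.box_mem h h' (by omega) (by omega) (by omega) (by omega)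
  -- The box above must carry the odd value `m + 1`, which leaves no value for its right neighbour.
  have h1 := hT.strict ⟨_, h⟩ ⟨_, h01⟩ ⟨i, j, j + 1, rfl, rfl, by omega⟩
  have h2 := hT.weak ⟨_, h01⟩ ⟨_, h11⟩ ⟨i, i + 1, j + 1, rfl, rfl, by omega⟩
  have h3 := hT.le ⟨_, h11⟩
  omega

theorem box_add_box_notMem_of_right (hC : IsCylindricSkewShape C) {x : Cylinder v u}
    (hx : x ∈ C) (h : x + box v u 1 0 ∉ C) : x + box v u 1 1 ∉ C := by
  obtain ⟨i, j, rfl⟩ := exists_box_eq x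
  intro hcon
  exact h (hC.box_mem hx hcon (by omega) (by omega) (by omega) (by omega))

/-- The diagonal through the missing right neighbour contains a box of `C`. By convexity it lies
below that neighbour, so the box under the row end is in between. -/
theorem box_mem_of_rowEnd (hC : IsCylindricSkewShape C)
    (hd : ∀ d : ℤ, ∃ i j : ℤ, box v u i j ∈ C ∧ ((v + u : ℕ) : ℤ) ∣ i - j - d) {i j : ℤ}
    (hx : box v u i j ∈ C) (h : box v u (i + 1) j ∉ C) : box v u i (j - 1) ∈ C := by
  obtain ⟨i', j', hy, hdvd⟩ := hd (i + 1 - j)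
  have hdiag : diagonal v u (box v u (i + 1) j) = diagonal v u (box v u i' j') := by
    rw [diagonal_box, diagonal_box, ZMod.intCast_eq_intCast_iff_dvd_sub]
    exact hdvd
  obtain ⟨t, ht⟩ := exists_box_of_diagonal_eq hdiag
  rw [ht] at hy
  rcases lt_or_ge t 0 with h0 | h0
  · exact hC.box_mem hy hx (by omega) (by omega) (by omega) (by omega)
  · exact absurd (hC.box_mem hx hy (by omega) (by omega) (by omega) (by omega)) h

/-- If the top ribbon of `C` is a closed loop, then the two largest values of a super tableau that
uses them `v + u` times in all fill the top ribbon, and the largest one fills the row ends. -/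
theorem IsSuperTableau.mult_eq_card_rowEnds (hC : IsCylindricSkewShape C) (hv : 0 < v)
    (hd : ∀ d : ℤ, ∃ i j : ℤ, box v u i j ∈ C ∧ ((v + u : ℕ) : ℤ) ∣ i - j - d) {m : ℕ}
    {T : {x // x ∈ C} → ℕ}
    (hT : IsSuperTableau (fun x y : {x // x ∈ C} => LeftOf x.1 y.1)
      (fun x y : {x // x ∈ C} => Below x.1 y.1) (m + 1) T)
    (hcard : v + u ≤ mult T m + mult T (m + 1)) :
    mult T m + mult T (m + 1) = v + u ∧ mult T (m + 1) = (rowEnds C).card := by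
  classical
  rw [mult_add_mult_eq_card hT.le] at hcard ⊢
  have hsub : (Finset.univ.filter fun x => m ≤ T x) ⊆ ribbonBoxes C := by
    rintro ⟨x, hxC⟩ hx
    obtain ⟨i, j, rfl⟩ := exists_box_eq x
    rw [mem_ribbonBoxes]
    intro hcon
    exact hT.lt_of_diagonal hC i j 1 hxC hcon one_pos (Finset.mem_filter.1 hx).2
  have hle := card_ribbonBoxes_le hC hv
  -- The ribbon has at most one box on each diagonal, so `v + u` boxes exhaust it.
  have heq := Finset.eq_of_subset_of_card_le hsub (hle.trans hcard)
  refine ⟨le_antisymm ((Finset.card_le_card hsub).trans hle) hcard, ?_⟩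
  have hmem : ∀ x : {x // x ∈ C}, x.1 + box v u 1 1 ∉ C → m ≤ T x := fun x hx =>
    (Finset.mem_filter.1 (heq ▸ mem_ribbonBoxes.2 hx : x ∈ Finset.univ.filter fun x => m ≤ T x)).2
  unfold mult
  congr 1
  ext ⟨x, hxC⟩
  obtain ⟨i, j, rfl⟩ := exists_box_eq x
  rw [mem_rowEnds, Finset.mem_filter, box_add_box, add_zero]
  simp only [Finset.mem_univ, true_and]
  constructor
  · intro hTx hcon
    have h1 := hT.weak ⟨_, hxC⟩ ⟨_, hcon⟩ ⟨i, i + 1, j, rfl, rfl, by omega⟩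
    have h2 := hT.le ⟨_, hcon⟩
    omega
  · intro h
    have hr : box v u i j + box v u 1 1 ∉ C :=
      box_add_box_notMem_of_right hC hxC (by rwa [box_add_box, add_zero])
    -- The box under a row end is also on the ribbon, so its value is at least `m`; strictness then
    -- forces `m + 1` at the row end.
    have hbelow := box_mem_of_rowEnd hC hd hxC h
    have h1 := hmem ⟨_, hxC⟩ hr
    have h2 := hmem ⟨_, hbelow⟩ (by
      rwa [box_add_box, sub_add_cancel])
    have h3 := hT.strict ⟨_, hbelow⟩ ⟨_, hxC⟩ ⟨i, j - 1, j, rfl, rfl, by omega⟩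
    have h4 := hT.le ⟨_, hxC⟩
    omega

theorem mem_removeTopRibbon {x : Cylinder v u} :
    x ∈ removeTopRibbon C ↔ x ∈ C ∧ x + box v u 1 1 ∈ C := by
  classical
  simp only [removeTopRibbon, topRibbon, Finset.mem_sdiff, Finset.mem_filter, not_and, not_not]
  exact ⟨fun h => ⟨h.1, h.2 h.1⟩, fun h => ⟨h.1, fun _ => h.2⟩⟩

open Classical in
/-- The number of boxes of `C` without its top ribbon that lie below a given box. -/
noncomputable def height (C : Finset (Cylinder v u)) (x : Cylinder v u) : ℕ :=
  ((removeTopRibbon C).filter fun y => Below y x).card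

theorem height_lt_maxColumnCard (hu : 0 < u) {x : Cylinder v u} (hx : x ∈ removeTopRibbon C) :
    height C x < maxColumnCard (removeTopRibbon C) := by
  classical
  obtain ⟨i, j, rfl⟩ := exists_box_eq x
  have hu' : (0 : ℤ) < u := by exact_mod_cast hu
  have h0 := Int.emod_nonneg i hu'.ne'
  have h1 := Int.emod_lt_of_pos i hu'
  have hcast : ((i % u).toNat : ℤ) = i % u := Int.toNat_of_nonneg h0
  have hcol : ∀ j : ℤ, box v u i j = box v u (i % u) (j + i / u * v) := fun j =>
    box_eq_box_iff.2 ⟨i / u, by rw [Int.emod_def]; ring, rfl⟩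
  calc height C (box v u i j)
      < (insert (box v u i j)
          ((removeTopRibbon C).filter fun y => Below y (box v u i j))).card := by
        rw [Finset.card_insert_of_notMem (by simp [not_below_self hu])]
        exact Nat.lt_succ_self _
    _ ≤ (column (removeTopRibbon C) (((i % u).toNat : ℕ) : ℤ)).card := by
        refine Finset.card_le_card fun y hy => ?_
        rw [hcast, column, Finset.mem_filter]
        rcases Finset.mem_insert.1 hy with rfl | hy
        · exact ⟨hx, _, hcol j⟩
        · rw [Finset.mem_filter] at hy
          obtain ⟨j', rfl, -⟩ := exists_box_of_below hy.2
          exact ⟨hy.1, _, hcol j'⟩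
    _ ≤ maxColumnCard (removeTopRibbon C) :=
        Finset.le_sup (f := fun q : ℕ => (column (removeTopRibbon C) (q : ℤ)).card)
          (Finset.mem_range.2 (by omega))

theorem height_lt_height (hu : 0 < u) {i j j' : ℤ} (hj : j < j')
    (h : box v u i j ∈ removeTopRibbon C) :
    height C (box v u i j) < height C (box v u i j') := by
  classical
  refine Finset.card_lt_card ⟨fun y hy => ?_, fun hcon => ?_⟩
  · rw [Finset.mem_filter] at hy ⊢
    obtain ⟨j₀, rfl, h0⟩ := exists_box_of_below hy.2
    exact ⟨hy.1, i, j₀, j', rfl, rfl, by omega⟩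
  · have h1 := hcon (Finset.mem_filter.2 ⟨h, i, j, j', rfl, rfl, hj⟩)
    exact not_below_self hu _ (Finset.mem_filter.1 h1).2

/-- By convexity, horizontal translation carries the boxes counted below the left box injectively to
boxes counted below the right one. -/
theorem height_le_height (hC : IsCylindricSkewShape C) {i i' j : ℤ} (hi : i < i')
    (h' : box v u i' j ∈ removeTopRibbon C) :
    height C (box v u i j) ≤ height C (box v u i' j) := by
  classical
  rw [mem_removeTopRibbon, box_add_box] at h'
  refine Finset.card_le_card_of_injOn (fun y => y + box v u (i' - i) 0) ?_
    (fun _ _ _ _ h => add_right_cancel h)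
  intro y hy
  rw [Finset.mem_coe, Finset.mem_filter] at hy
  obtain ⟨hy, hb⟩ := hy
  obtain ⟨j₀, rfl, h0⟩ := exists_box_of_below hb
  rw [mem_removeTopRibbon, box_add_box] at hy
  rw [Finset.mem_coe, Finset.mem_filter, mem_removeTopRibbon]
  simp only [box_add_box]
  exact ⟨⟨hC.box_mem hy.1 h'.1 (by omega) (by omega) (by omega) (by omega),
    hC.box_mem hy.2 h'.2 (by omega) (by omega) (by omega) (by omega)⟩,
    i', j₀, j, by congr 1 <;> omega, rfl, h0⟩

open Classical in
/-- The filling of the top ribbon by `m` and `m + 1`, and of the rest by the heights. -/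
noncomputable def loopFilling (C : Finset (Cylinder v u)) (m : ℕ) (x : {x // x ∈ C}) : ℕ :=
  if x.1 + box v u 1 1 ∈ C then height C x.1 else if x.1 + box v u 1 0 ∈ C then m else m + 1

open Classical in
theorem loopFilling_box {m : ℕ} {i j : ℤ} (h : box v u i j ∈ C) :
    loopFilling C m ⟨_, h⟩ = if box v u (i + 1) (j + 1) ∈ C then height C (box v u i j) else
      if box v u (i + 1) (j + 0) ∈ C then m else m + 1 :=
  rfl

/-- Heights are smaller than both ribbon values. In a row, a ribbon box with another to its right is
no row end and gets `m`; in a column, a ribbon box above another is a row end by convexity and gets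
`m + 1`. -/
theorem loopFilling_isSuperTableau (hC : IsCylindricSkewShape C) (hu : 0 < u) :
    IsSuperTableau (fun x y : {x // x ∈ C} => LeftOf x.1 y.1)
      (fun x y : {x // x ∈ C} => Below x.1 y.1) (maxColumnCard (removeTopRibbon C) + 1)
      (loopFilling C (maxColumnCard (removeTopRibbon C))) := by
  classical
  have hlt : ∀ x ∈ C, x + box v u 1 1 ∈ C → height C x < maxColumnCard (removeTopRibbon C) :=
    fun x hx h => height_lt_maxColumnCard hu (mem_removeTopRibbon.2 ⟨hx, h⟩)
  refine ⟨?_, ?_, ?_⟩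
  · rintro ⟨x, hx⟩
    have := hlt x hx
    unfold loopFilling
    dsimp only
    split_ifs with h1 h2
    · have := this h1; omega
    · omega
    · omega
  · rintro ⟨_, hx⟩ ⟨_, hy⟩ ⟨i, i', j, rfl, rfl, h⟩
    have h10 : box v u (i + 1) (j + 0) ∈ C :=
      hC.box_mem hx hy (by omega) (by omega) (by omega) (by omega)
    have hmono : box v u (i' + 1) (j + 1) ∈ C → box v u (i + 1) (j + 1) ∈ C := fun h' =>
      hC.box_mem hx h' (by omega) (by omega) (by omega) (by omega)
    have hltx := hlt _ hx
    have hle : box v u (i' + 1) (j + 1) ∈ C →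
        height C (box v u i j) ≤ height C (box v u i' j) := fun h' =>
      height_le_height hC h (mem_removeTopRibbon.2 ⟨hy, h'⟩)
    simp only [loopFilling_box, box_add_box] at *
    rw [if_pos h10]
    by_cases h1 : box v u (i' + 1) (j + 1) ∈ C
    · rw [if_pos h1, if_pos (hmono h1)]
      have := hle h1
      have := hltx (hmono h1)
      omega
    · rw [if_neg h1]
      by_cases h2 : box v u (i + 1) (j + 1) ∈ C
      · rw [if_pos h2]
        have := hltx h2
        split_ifs <;> omega
      · rw [if_neg h2]
        split_ifs <;> omega
  · rintro ⟨_, hx⟩ ⟨_, hy⟩ ⟨i, j, j', rfl, rfl, h⟩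
    have hmono : box v u (i + 1) (j' + 0) ∈ C → box v u (i + 1) (j + 1) ∈ C := fun h' =>
      hC.box_mem hx h' (by omega) (by omega) (by omega) (by omega)
    have hmono' : box v u (i + 1) (j' + 1) ∈ C → box v u (i + 1) (j + 1) ∈ C := fun h' =>
      hC.box_mem hx h' (by omega) (by omega) (by omega) (by omega)
    have hltx := hlt _ hx
    have hle : box v u (i + 1) (j + 1) ∈ C →
        height C (box v u i j) < height C (box v u i j') := fun h' =>
      height_lt_height hu h (mem_removeTopRibbon.2 ⟨hx, h'⟩)
    simp only [loopFilling_box, box_add_box] at *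
    by_cases h1 : box v u (i + 1) (j + 1) ∈ C
    · rw [if_pos h1]
      have := hltx h1
      have := hle h1
      split_ifs <;> omega
    · rw [if_neg h1, if_neg (fun h2 => h1 (hmono' h2)), if_neg (fun h2 => h1 (hmono h2))]
      split_ifs <;> omega

theorem mult_loopFilling (hC : IsCylindricSkewShape C) (hu : 0 < u) :
    mult (loopFilling C (maxColumnCard (removeTopRibbon C))) (maxColumnCard (removeTopRibbon C)) +
      mult (loopFilling C (maxColumnCard (removeTopRibbon C)))
        (maxColumnCard (removeTopRibbon C) + 1) = (ribbonBoxes C).card := by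
  classical
  rw [mult_add_mult_eq_card (loopFilling_isSuperTableau hC hu).le]
  congr 1
  ext ⟨x, hx⟩
  rw [mem_ribbonBoxes, Finset.mem_filter]
  simp only [Finset.mem_univ, true_and, loopFilling]
  split_ifs with h1 h2
  · have := height_lt_maxColumnCard hu (mem_removeTopRibbon.2 ⟨hx, h1⟩)
    simp only [h1, not_true_eq_false, iff_false]
    omega
  · simp [h1]
  · simp [h1]

/-- If `C` meets every diagonal of a cylinder with at least two columns, then its Schur function is
not Schur-positive. -/
theorem not_isSchurPositive_of_all_diagonals (hC : IsCylindricSkewShape C) (hv : 0 < v)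
    (hu : 2 ≤ u)
    (hd : ∀ d : ℤ, ∃ i j : ℤ, box v u i j ∈ C ∧ ((v + u : ℕ) : ℤ) ∣ i - j - d) :
    ¬ IsSchurPositive (cylindricSchur (maxColumnCard (removeTopRibbon C) + v + 2) C) := by
  rw [cylindricSchur_eq_fillingPoly]
  have hends := card_rowEnds_le hC hv
  have hT := loopFilling_isSuperTableau hC (by omega : 0 < u)
  have hmult := mult_loopFilling hC (by omega : 0 < u)
  set m := maxColumnCard (removeTopRibbon C)
  have hribbon := le_card_ribbonBoxes hv hd
  obtain ⟨h1, h2⟩ := hT.mult_eq_card_rowEnds hC hv hd (by omega)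
  -- Corners are needed up to size `(rowEnds C).card + 1 ≤ v + 1`, which is below `v + u` because `2
  -- ≤ u`.
  refine not_isSchurPositive_fillingPoly (q := m) (n := v + u) (i := (rowEnds C).card) (by omega)
    (by omega) (hasCorners_cylinder hC (by omega)) (mult (loopFilling C m))
    ⟨loopFilling C m, ?_⟩ fun j hj => ?_
  · rw [mem_superTableaux]
    refine ⟨hT, fun w hw => ?_, h2⟩
    rcases Nat.lt_succ_iff_lt_or_eq.1 hw with hw | rfl
    · rw [Function.update_of_ne hw.ne]
    · rw [Function.update_self]
      omega
  · rw [Finset.eq_empty_iff_forall_notMem]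
    intro T hT'
    rw [mem_superTableaux] at hT'
    obtain ⟨h3, h4, h5⟩ := hT'
    have h6 := h4 m (Nat.lt_succ_self m)
    rw [Function.update_self] at h6
    -- With truncated subtraction `(v + u - j) + j` is at least `v + u` for every `j`, so large `j`
    -- are excluded as well.
    have h7 := h3.mult_eq_card_rowEnds hC hv hd (by omega)
    omega

end Loop

end CylindricSkew

/-! ### The main theorem. -/

theorem mainTheorem6 (k n : ℕ) (hk : 1 ≤ k) (hkn : k < n)
    (C : Finset (CylindricSkew.Cylinder k (n - k)))
    (hC : CylindricSkew.IsCylindricSkewShape C)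
    (hskew : ¬ CylindricSkew.IsIsomorphicToSkewShape C) :
    ¬ CylindricSkew.IsSchurPositive
        (CylindricSkew.cylindricSchur
          (CylindricSkew.maxColumnCard (CylindricSkew.removeTopRibbon C) + k + 2) C) := by
  rcases Nat.lt_or_ge (n - k) 2 with hu | hu
  · exact absurd (CylindricSkew.isIsomorphicToSkewShape_of_one_column (by omega) hC) hskew
  · refine CylindricSkew.not_isSchurPositive_of_all_diagonals hC hk hu fun d => ?_
    by_contra! hcon
    exact hskew (CylindricSkew.isIsomorphicToSkewShape_of_missing_diagonal hC (by omega) d hcon)
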